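/- Let $\mathcal A$ be a finite set, let $\mathbf R$ be a real $D\times|\mathcal A|$ matrix of full row rank $D$ whose row space contains the all-one vector (normalization is one of the constraints), and let $\mathbf f$ be a probability distribution on $\mathcal A$. Let $[\mathbf f]_{\mathbf R}$ be the set of probability distributions $\mathbf p$ on $\mathcal A$ with $\mathbf R\mathbf p=\mathbf R\mathbf f$, and suppose that there are no structural zeros: for every $\alpha\in\mathcal A$ some $\mathbf p\in[\mathbf f]_{\mathbf R}$ has $\mathbf p_\alpha>0$. Write $H[\mathbf p]=-\sum_\alpha \mathbf p_\alpha\log \mathbf p_\alpha$ (with $0\log 0=0$), $k=|\mathcal A|-D$, $\chi^2_k$ for the law of the sum of squares of $k$ independent standard normal variables (the point mass at $0$ if $k=0$), and $F_k$ for its cumulative distribution function. Then there is exactly one maximizer $\hat{\mathbf p}$ of $H$ on $[\mathbf f]_{\mathbf R}$ (the MaxEnt distribution), and the following holds for the probability law $P_N$ on $[\mathbf f]_{\mathbf R}$ that weights each member $\mathbf p$ proportionally to $\exp(N H[\mathbf p])$, in each of the two settings (a) $P_N$ has density proportional to $\exp(N H[\mathbf p])$ with respect to Lebesgue measure on the affine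 space $\mathbf f+\ker\mathbf R$, restricted to $[\mathbf f]_{\mathbf R}$, and $N\to\infty$; (b) the entries of $\mathbf R$ are rational, $P_N$ gives probability $\exp(N H[\mathbf p])/\sum_{\mathbf p'}\exp(N H[\mathbf p'])$ to each $\mathbf p\in[\mathbf f]_{\mathbf R}$ with $N\mathbf p\in\mathbb Z_{\ge 0}^{\mathcal A}$, where $\mathbf p'$ runs over the same finite set, and $N\to\infty$ through those $N$ for which this set is not empty. 1. For $\mathbf p$ distributed according to $P_N$, the scaled entropy gap $2N(H[\hat{\mathbf p}]-H[\mathbf p])$ converges in distribution to $\chi^2_k$ as $N\to\infty$. 2. The fraction of members with entropy within $\delta$ of the maximum is asymptotically $F_k(2N\delta)$, uniformly in $\delta>0$: $$\sup_{\delta>0}\Bigl|P_N\bigl\{\mathbf p\in[\mathbf f]_{\mathbf R}:\ H[\hat{\mathbf p}]-\delta\le H[\mathbf p]\le H[\hat{\mathbf p}]\bigr\}-F_k(2N\delta)\Bigr|\longrightarrow 0\qquad(N\to\infty).$$ -/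

import Mathlib

open MeasureTheory ProbabilityTheory Filter Topology
open scoped Matrix

noncomputable section

/-- Shannon entropy `- ∑ p_α log p_α`, with `0 log 0 = 0`. -/
def shannonEntropy {A : Type*} [Fintype A] (p : A → ℝ) : ℝ :=
  ∑ α, Real.negMulLog (p α)

/-- The equivalence class of `f` under the architecture matrix `R`: all probability distributions
on `A` that satisfy the same linear constraints as `f`. -/
def equivClass {A : Type*} [Fintype A] {D : ℕ} (R : Matrix (Fin D) A ℝ) (f : A → ℝ) :
    Set (A → ℝ) :=
  {p | p ∈ stdSimplex ℝ A ∧ R *ᵥ p = R *ᵥ f}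

/-- `q` maximizes the Shannon entropy over the equivalence class of `f`. -/
def IsMaxEnt {A : Type*} [Fintype A] {D : ℕ} (R : Matrix (Fin D) A ℝ) (f q : A → ℝ) : Prop :=
  q ∈ equivClass R f ∧ ∀ p ∈ equivClass R f, shannonEntropy p ≤ shannonEntropy q

/-- Members of the equivalence class that are relative frequencies of `N` records, that is,
whose counts `N p_α` are natural numbers. -/
def countClass {A : Type*} [Fintype A] {D : ℕ} (R : Matrix (Fin D) A ℝ) (f : A → ℝ) (N : ℕ) :
    Set (A → ℝ) :=
  {p | p ∈ equivClass R f ∧ ∀ α, ∃ n : ℕ, (N : ℝ) * p α = n}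

/-- Lebesgue measure on the affine solution space `f + ker R`, restricted to the equivalence
class. Its normalization (a choice of Haar measure on `ker R`) cancels in `entropyLaw`. -/
def classVolume {A : Type*} [Fintype A] {D : ℕ} (R : Matrix (Fin D) A ℝ) (f : A → ℝ) :
    Measure (A → ℝ) :=
  ((Measure.addHaar : Measure (LinearMap.ker R.mulVecLin)).map
    (fun v : LinearMap.ker R.mulVecLin => f + v.1)).restrict (equivClass R f)

/-- The probability law obtained from a reference measure `ρ` by weighting each `p` with
`exp (N H[p])` and dividing by the total weight. -/
def entropyLaw {A : Type*} [Fintype A] (ρ : Measure (A → ℝ)) (N : ℕ) : Measure (A → ℝ) :=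
  (∫⁻ p, ENNReal.ofReal (Real.exp (N * shannonEntropy p)) ∂ρ)⁻¹ •
    ρ.withDensity (fun p => ENNReal.ofReal (Real.exp (N * shannonEntropy p)))

/-- The chi-squared distribution with `k` degrees of freedom: the law of the sum of squares of
`k` independent standard normal variables (the point mass at `0` if `k = 0`). -/
def chiSquared (k : ℕ) : Measure ℝ :=
  (Measure.pi (fun _ : Fin k => gaussianReal 0 1)).map (fun x => ∑ i, x i ^ 2)

/-- Along the filter `l` of sample sizes, for `p` drawn from the laws `P N` on the equivalence
class, the scaled entropy gap `2 N (H[q] - H[p])` converges in distribution to chi-squared with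
`k` degrees of freedom, and, uniformly in `δ > 0`, the probability that the entropy of `p` lies in
`[H[q] - δ, H[q]]` is asymptotically `F_k (2 N δ)`. -/
def EntropyConcentrates {A : Type*} [Fintype A] {D : ℕ} (R : Matrix (Fin D) A ℝ) (f q : A → ℝ)
    (k : ℕ) (l : Filter ℕ) (P : ℕ → Measure (A → ℝ)) : Prop :=
  (∀ᶠ N in l, IsProbabilityMeasure (P N)) ∧
  (∀ φ : BoundedContinuousFunction ℝ ℝ,
    Tendsto (fun N : ℕ => ∫ p, φ (2 * N * (shannonEntropy q - shannonEntropy p)) ∂(P N)) l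
      (𝓝 (∫ x, φ x ∂(chiSquared k)))) ∧
  (∀ ε > (0 : ℝ), ∀ᶠ N in l, ∀ δ > (0 : ℝ),
    |(P N).real {p | p ∈ equivClass R f ∧ shannonEntropy q - δ ≤ shannonEntropy p ∧
        shannonEntropy p ≤ shannonEntropy q} - cdf (chiSquared k) (2 * N * δ)| < ε)

end

/-! The argument is Laplace's method around the maximizer `q`. Infinite slope of `Real.negMulLog` at
0 forces `q` to be positive everywhere (`IsMaxEnt.pos`), so `q` is stationary along `ker R` and the
entropy gap is exactly a Kullback-Leibler divergence (`IsMaxEnt.entropy_gap`). That divergence has a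
global quadratic lower bound (`sq_sub_le_klTerm`), which gives uniqueness and Gaussian domination,
and a second-order expansion at `q` (`tendsto_mul_klTerm`), which identifies the limit.

Write `p = q + B x / √N` with `B` a linear parametrization of `ker R` by `k` coordinates. Then `2N`
times the gap tends to the quadratic form `∑ (B x)_α² / q_α`, and its weight to the Gaussian `exp
(-quadGap / 2)`. An orthonormal change of variables turns the form into a sum of `k` squares, hence
chi-squared; all Jacobians and normalizations cancel in the quotient of integrals.

Both settings are instances of `entropyConcentrates_of_coordinates`. In the discrete one, a sum over
lattice points is an integral of a function constant on cells of side `1/√N`, so `x` is replaced by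
a rounding `r N x`, and dominated convergence still applies. Uniformity in `δ` is Pólya's theorem,
except for `k = 0`, where the limit has an atom but the class is the single point `q`. -/

/-! ### Scalar estimates for the divergence. -/

/-- The summand of the generalized Kullback-Leibler divergence of `p` from `q`. -/
noncomputable def klTerm (q p : ℝ) : ℝ := p * Real.log p - p * Real.log q - p + q

/-- In terms of square roots, `log t ≤ t - 1` at `t = √q / √p` bounds the term below by `(√p -
√q)²`, and `√p + √q ≤ 2`. -/
lemma sq_sub_le_klTerm {q p : ℝ} (hp : 0 ≤ p) (hp1 : p ≤ 1) (hq : 0 < q) (hq1 : q ≤ 1) :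
    (p - q) ^ 2 / 4 ≤ klTerm q p := by
  unfold klTerm
  rcases hp.eq_or_lt with rfl | hp
  · simp only [zero_mul, Real.log_zero]
    nlinarith
  set a := √p
  set b := √q
  have ha : 0 < a := Real.sqrt_pos.2 hp
  have hb : 0 < b := Real.sqrt_pos.2 hq
  have hap : a ^ 2 = p := Real.sq_sqrt hp.le
  have hbq : b ^ 2 = q := Real.sq_sqrt hq.le
  have ha1 : a ≤ 1 := by nlinarith
  have hb1 : b ≤ 1 := by nlinarith
  rw [← hap, ← hbq, Real.log_pow, Real.log_pow]
  have hlog : Real.log b - Real.log a ≤ b / a - 1 := by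
    rw [← Real.log_div hb.ne' ha.ne']
    exact Real.log_le_sub_one_of_pos (by positivity)
  have h2 : a ^ 2 * (Real.log b - Real.log a) ≤ a * b - a ^ 2 := by
    have := mul_le_mul_of_nonneg_left hlog (sq_nonneg a)
    have e : a ^ 2 * (b / a - 1) = a * b - a ^ 2 := by field_simp
    linarith
  have h3 : (a ^ 2 - b ^ 2) ^ 2 / 4 ≤ (a - b) ^ 2 := by
    have : (a + b) ^ 2 ≤ 4 := by nlinarith
    have := mul_le_mul_of_nonneg_left this (sq_nonneg (a - b))
    nlinarith
  push_cast
  linarith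

lemma abs_one_add_mul_log_sub_le {u : ℝ} (hu : |u| ≤ 1 / 2) :
    |(1 + u) * Real.log (1 + u) - u - u ^ 2 / 2| ≤ 4 * |u| ^ 3 := by
  have h := Real.abs_log_sub_add_sum_range_le (x := -u) (by rw [abs_neg]; linarith) 2
  simp only [Finset.sum_range_succ, Finset.sum_range_zero, abs_neg, sub_neg_eq_add] at h
  norm_num at h
  have h2 : |u| ^ 3 / (1 - |u|) ≤ 2 * |u| ^ 3 := by
    rw [div_le_iff₀ (by linarith)]
    have : 0 ≤ |u| ^ 3 := by positivity
    nlinarith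
  set e := -u + u ^ 2 / 2 + Real.log (1 + u)
  have he : (1 + u) * Real.log (1 + u) - u - u ^ 2 / 2 = -(u ^ 3 / 2) + (1 + u) * e := by
    simp only [e]; ring
  have hu1 : |1 + u| ≤ 3 / 2 := by
    have := abs_add_le 1 u
    rw [abs_one] at this
    linarith
  rw [he]
  calc _ ≤ |-(u ^ 3 / 2)| + |(1 + u) * e| := abs_add_le _ _
    _ = |u| ^ 3 / 2 + |1 + u| * |e| := by
        rw [abs_neg, abs_div, abs_pow, abs_mul]; norm_num
    _ ≤ |u| ^ 3 / 2 + 3 / 2 * (2 * |u| ^ 3) := by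
        gcongr
        exact h.trans h2
    _ ≤ _ := by
        have : 0 ≤ |u| ^ 3 := by positivity
        linarith

/-- At `p = q` the term vanishes to second order with second derivative `1 / q`; at scale `1 / √n`
the cubic remainder is negligible even after multiplication by `n`. The direction `w` may vary, to
allow for rounding. -/
lemma tendsto_mul_klTerm {ι : Type*} {l : Filter ι} {n w : ι → ℝ} {w₀ q : ℝ}
    (hn : Tendsto n l atTop) (hw : Tendsto w l (𝓝 w₀)) (hq : 0 < q) :
    Tendsto (fun i => n i * klTerm q (q + (√(n i))⁻¹ * w i)) l (𝓝 (w₀ ^ 2 / q / 2)) := by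
  set u : ι → ℝ := fun i => (√(n i))⁻¹ * w i / q
  have hu : Tendsto u l (𝓝 0) := by
    have h1 : Tendsto (fun i => (√(n i))⁻¹) l (𝓝 0) :=
      tendsto_inv_atTop_zero.comp (Real.tendsto_sqrt_atTop.comp hn)
    simpa using (h1.mul hw).div_const q
  have hnu : Tendsto (fun i => n i * u i ^ 2) l (𝓝 (w₀ ^ 2 / q ^ 2)) := by
    refine ((hw.pow 2).div_const (q ^ 2)).congr' ?_
    filter_upwards [hn.eventually_gt_atTop 0] with i hi
    simp only [u, div_pow, mul_pow, inv_pow, Real.sq_sqrt hi.le]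
    field_simp
  have hmain : Tendsto (fun i => q * (n i * u i ^ 2) / 2) l (𝓝 (w₀ ^ 2 / q / 2)) := by
    have := (hnu.const_mul q).div_const 2
    convert this using 2
    field_simp
  have hsmall : Tendsto (fun i => n i * klTerm q (q + (√(n i))⁻¹ * w i)
      - q * (n i * u i ^ 2) / 2) l (𝓝 0) := by
    have hb : Tendsto (fun i => 4 * q * (n i * u i ^ 2) * |u i|) l (𝓝 0) := by
      simpa using (hnu.const_mul (4 * q)).mul hu.abs
    refine squeeze_zero_norm' ?_ hb
    filter_upwards [hn.eventually_gt_atTop 0,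
      hu.abs.eventually_le_const (show |(0 : ℝ)| < 1 / 2 by norm_num)] with i hi hui
    have h1 : q + (√(n i))⁻¹ * w i = q * (1 + u i) := by
      simp only [u]; field_simp
    have hpos : 0 < 1 + u i := by
      have := (abs_le.1 hui).1; linarith
    have h2 : klTerm q (q * (1 + u i)) = q * ((1 + u i) * Real.log (1 + u i) - u i) := by
      rw [klTerm, Real.log_mul hq.ne' hpos.ne']; ring
    rw [h1, h2, Real.norm_eq_abs]
    have h3 : n i * (q * ((1 + u i) * Real.log (1 + u i) - u i)) - q * (n i * u i ^ 2) / 2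
        = n i * q * ((1 + u i) * Real.log (1 + u i) - u i - u i ^ 2 / 2) := by ring
    rw [h3, abs_mul, abs_of_pos (by positivity : 0 < n i * q)]
    calc _ ≤ n i * q * (4 * |u i| ^ 3) := by
          gcongr
          exact abs_one_add_mul_log_sub_le hui
      _ = _ := by rw [pow_succ, sq_abs]; ring
  simpa using hsmall.add hmain

/-! ### The maximizer and the entropy gap. -/

section MaxEnt

variable {A : Type*} [Fintype A] {D : ℕ} {R : Matrix (Fin D) A ℝ} {f q : A → ℝ}

lemma continuous_shannonEntropy : Continuous (shannonEntropy : (A → ℝ) → ℝ) :=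
  continuous_finsetSum _ fun α _ => Real.continuous_negMulLog.comp (continuous_apply α)

lemma isClosed_equivClass (R : Matrix (Fin D) A ℝ) (f : A → ℝ) : IsClosed (equivClass R f) :=
  (isClosed_stdSimplex ℝ A).inter
    (isClosed_eq (Continuous.matrix_mulVec continuous_const continuous_id) continuous_const)

lemma convex_equivClass (R : Matrix (Fin D) A ℝ) (f : A → ℝ) : Convex ℝ (equivClass R f) := by
  intro x hx y hy a b ha hb hab
  refine ⟨convex_stdSimplex ℝ A hx.1 hy.1 ha hb hab, ?_⟩
  rw [Matrix.mulVec_add, Matrix.mulVec_smul, Matrix.mulVec_smul, hx.2, hy.2, ← add_smul, hab,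
    one_smul]

lemma exists_isMaxEnt (hf : f ∈ stdSimplex ℝ A) : ∃ q, IsMaxEnt R f q := by
  have hc : IsCompact (equivClass R f) :=
    (isCompact_stdSimplex ℝ A).of_isClosed_subset (isClosed_equivClass R f) fun p hp => hp.1
  obtain ⟨q, hq, hmax⟩ := hc.exists_isMaxOn ⟨f, hf, rfl⟩ continuous_shannonEntropy.continuousOn
  exact ⟨q, hq, fun p hp => hmax hp⟩

lemma sum_eq_zero_of_mulVec_eq_zero (hnorm : ∃ c : Fin D → ℝ, c ᵥ* R = fun _ => 1) {v : A → ℝ}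
    (hv : R *ᵥ v = 0) : ∑ α, v α = 0 := by
  obtain ⟨c, hc⟩ := hnorm
  have : c ᵥ* R ⬝ᵥ v = 0 := by rw [← Matrix.dotProduct_mulVec, hv, dotProduct_zero]
  rw [hc] at this
  simpa [dotProduct] using this

lemma add_mem_equivClass (hnorm : ∃ c : Fin D → ℝ, c ᵥ* R = fun _ => 1)
    (hq : q ∈ equivClass R f) {v : A → ℝ} (hv : R *ᵥ v = 0) (h0 : ∀ α, 0 ≤ (q + v) α) :
    q + v ∈ equivClass R f := by
  refine ⟨⟨h0, ?_⟩, by rw [Matrix.mulVec_add, hv, add_zero, hq.2]⟩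
  simp only [Pi.add_apply, Finset.sum_add_distrib]
  rw [hq.1.2, sum_eq_zero_of_mulVec_eq_zero hnorm hv, add_zero]

lemma mulVec_sub_eq_zero {p : A → ℝ} (hp : p ∈ equivClass R f) (hq : q ∈ equivClass R f) :
    R *ᵥ (p - q) = 0 := by
  rw [Matrix.mulVec_sub, hp.2, hq.2, sub_self]

/-- If `q α = 0`, moving a fraction `t` towards `p` gains `t * p α * log (1 / t)` in coordinate `α`,
while by concavity the rest costs at most `t` times the entropy difference. Small `t` contradicts
maximality. -/
lemma IsMaxEnt.pos (hq : IsMaxEnt R f q) (hpos : ∀ α, ∃ p ∈ equivClass R f, 0 < p α) (α : A) :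
    0 < q α := by
  by_contra hneg
  have hq0 : q α = 0 := le_antisymm (not_lt.1 hneg) (hq.1.1.1 α)
  obtain ⟨p, hp, hpα⟩ := hpos α
  have hpq : shannonEntropy p ≤ shannonEntropy q := hq.2 p hp
  -- Chosen so that with `t = exp (-M)` the gain exceeds the cost by `t * p α`.
  set M := (shannonEntropy q - shannonEntropy p) / p α + 1
  have hM : 0 < M := by
    have : 0 ≤ (shannonEntropy q - shannonEntropy p) / p α :=
      div_nonneg (by linarith) hpα.le
    simp only [M]; linarith
  set t := Real.exp (-M)
  have ht0 : 0 < t := Real.exp_pos _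
  have ht1 : t < 1 := Real.exp_lt_one_iff.2 (by linarith)
  have hmem : (1 - t) • q + t • p ∈ equivClass R f :=
    convex_equivClass R f hq.1 hp (by linarith) ht0.le (by ring)
  have hle := hq.2 _ hmem
  have hconc : ∀ β, (1 - t) * Real.negMulLog (q β) + t * Real.negMulLog (p β)
      ≤ Real.negMulLog (((1 - t) • q + t • p) β) := fun β =>
    Real.concaveOn_negMulLog.2 (hq.1.1.1 β) (hp.1.1 β) (by linarith) ht0.le (by ring)
  have hα : Real.negMulLog (((1 - t) • q + t • p) α)
      = (1 - t) * Real.negMulLog (q α) + t * Real.negMulLog (p α) + t * p α * M := by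
    simp only [Pi.add_apply, Pi.smul_apply, smul_eq_mul, hq0, mul_zero, zero_add,
      Real.negMulLog]
    rw [Real.log_mul ht0.ne' hpα.ne', Real.log_exp]
    ring
  have hsum : (1 - t) * shannonEntropy q + t * shannonEntropy p + t * p α * M
      ≤ shannonEntropy ((1 - t) • q + t • p) := by
    classical
    simp only [shannonEntropy, Finset.mul_sum]
    rw [← Finset.sum_add_distrib, ← Finset.add_sum_erase _ _ (Finset.mem_univ α),
      ← Finset.add_sum_erase (a := α) _ (fun β => Real.negMulLog (((1 - t) • q + t • p) β))
        (Finset.mem_univ α), hα]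
    have := Finset.sum_le_sum fun β (_ : β ∈ Finset.univ.erase α) => hconc β
    linarith
  have hkey : p α * M = shannonEntropy q - shannonEntropy p + p α := by
    simp only [M]; field_simp
  have : t * (p α * M) ≤ t * (shannonEntropy q - shannonEntropy p) := by linarith
  have := le_of_mul_le_mul_left this ht0
  linarith

/-- Positivity of `q` allows small moves along `v` in both directions, so the derivative of the
entropy vanishes; its constant part drops out because `v` sums to zero. -/
lemma IsMaxEnt.sum_mul_log_eq_zero (hq : IsMaxEnt R f q) (hq0 : ∀ α, 0 < q α)
    (hnorm : ∃ c : Fin D → ℝ, c ᵥ* R = fun _ => 1) {v : A → ℝ} (hv : R *ᵥ v = 0) :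
    ∑ α, v α * Real.log (q α) = 0 := by
  have hder : HasDerivAt (fun t : ℝ => shannonEntropy (q + t • v))
      (∑ α, (-Real.log (q α) - 1) * v α) 0 := by
    simp only [shannonEntropy]
    refine HasDerivAt.fun_sum fun α _ => ?_
    have h1 : HasDerivAt (fun t : ℝ => (q + t • v) α) (v α) 0 := by
      simpa using ((hasDerivAt_id (0 : ℝ)).mul_const (v α)).const_add (q α)
    have h2 := Real.hasDerivAt_negMulLog (hq0 α).ne'
    have h3 : (q + (0 : ℝ) • v) α = q α := by simp
    rw [← h3] at h2
    have h4 := HasDerivAt.comp (0 : ℝ) h2 h1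
    rw [h3] at h4
    exact h4
  have hmax : IsLocalMax (fun t : ℝ => shannonEntropy (q + t • v)) 0 := by
    have hev : ∀ᶠ t : ℝ in 𝓝 0, ∀ α, 0 < (q + t • v) α := by
      refine eventually_all.2 fun α => ?_
      have hc : Continuous fun t : ℝ => (q + t • v) α := by
        simp only [Pi.add_apply, Pi.smul_apply, smul_eq_mul]; fun_prop
      have := hc.tendsto 0
      exact this.eventually_const_lt (by simpa using hq0 α)
    filter_upwards [hev] with t ht
    simp only [zero_smul, add_zero]
    refine hq.2 _ (add_mem_equivClass hnorm hq.1 ?_ fun α => (ht α).le)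
    rw [Matrix.mulVec_smul, hv, smul_zero]
  have h0 := hmax.hasDerivAt_eq_zero hder
  have hs := sum_eq_zero_of_mulVec_eq_zero hnorm hv
  have : ∑ α, (-Real.log (q α) - 1) * v α = -(∑ α, v α * Real.log (q α)) - ∑ α, v α := by
    rw [← Finset.sum_neg_distrib, ← Finset.sum_sub_distrib]
    exact Finset.sum_congr rfl fun α _ => by ring
  linarith

/-- The terms by which the divergence differs from the entropy gap are linear in `p - q`, and vanish
by stationarity and normalization. -/
lemma IsMaxEnt.entropy_gap (hq : IsMaxEnt R f q) (hq0 : ∀ α, 0 < q α)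
    (hnorm : ∃ c : Fin D → ℝ, c ᵥ* R = fun _ => 1) {p : A → ℝ} (hp : p ∈ equivClass R f) :
    shannonEntropy q - shannonEntropy p = ∑ α, klTerm (q α) (p α) := by
  have h1 := hq.sum_mul_log_eq_zero hq0 hnorm (mulVec_sub_eq_zero hp hq.1)
  have h2 := sum_eq_zero_of_mulVec_eq_zero hnorm (mulVec_sub_eq_zero hp hq.1)
  have : ∑ α, klTerm (q α) (p α) = shannonEntropy q - shannonEntropy p
      - ∑ α, (p - q) α * Real.log (q α) - ∑ α, (p - q) α := by
    simp only [shannonEntropy, ← Finset.sum_sub_distrib]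
    refine Finset.sum_congr rfl fun α _ => ?_
    simp only [klTerm, Real.negMulLog, Pi.sub_apply]
    ring
  linarith

lemma le_one_of_mem_stdSimplex {p : A → ℝ} (hp : p ∈ stdSimplex ℝ A) (α : A) : p α ≤ 1 :=
  hp.2 ▸ Finset.single_le_sum (fun β _ => hp.1 β) (Finset.mem_univ α)

lemma IsMaxEnt.sum_sq_le_entropy_gap (hq : IsMaxEnt R f q) (hq0 : ∀ α, 0 < q α)
    (hnorm : ∃ c : Fin D → ℝ, c ᵥ* R = fun _ => 1) {p : A → ℝ} (hp : p ∈ equivClass R f) :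
    ∑ α, (p α - q α) ^ 2 / 4 ≤ shannonEntropy q - shannonEntropy p := by
  rw [hq.entropy_gap hq0 hnorm hp]
  exact Finset.sum_le_sum fun α _ => sq_sub_le_klTerm (hp.1.1 α)
    (le_one_of_mem_stdSimplex hp.1 α) (hq0 α) (le_one_of_mem_stdSimplex hq.1.1 α)

lemma existsUnique_isMaxEnt (hf : f ∈ stdSimplex ℝ A)
    (hnorm : ∃ c : Fin D → ℝ, c ᵥ* R = fun _ => 1)
    (hpos : ∀ α, ∃ p ∈ equivClass R f, 0 < p α) : ∃! q, IsMaxEnt R f q := by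
  obtain ⟨q, hq⟩ := exists_isMaxEnt (R := R) hf
  refine ⟨q, hq, fun p hp => ?_⟩
  have h1 := hq.sum_sq_le_entropy_gap (hq.pos hpos) hnorm hp.1
  have h2 := hp.2 q hq.1
  have h3 : ∑ α, (p α - q α) ^ 2 / 4 = 0 :=
    le_antisymm (by linarith) (Finset.sum_nonneg fun α _ => by positivity)
  ext α
  have := (Finset.sum_eq_zero_iff_of_nonneg fun α _ => by positivity).1 h3 α (Finset.mem_univ α)
  have : (p α - q α) ^ 2 = 0 := by linarith
  linarith [pow_eq_zero_iff (two_ne_zero) |>.1 this]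

end MaxEnt

/-! ### Laplace's method in linear coordinates. -/

/-- Twice the quadratic approximation at `q` of the entropy gap, in linear coordinates `B`. -/
noncomputable def quadGap {A : Type*} [Fintype A] {k : ℕ} (q : A → ℝ)
    (B : (Fin k → ℝ) →ₗ[ℝ] A → ℝ) (x : Fin k → ℝ) : ℝ :=
  ∑ α, B x α ^ 2 / q α

lemma integrable_exp_neg_mul_sum_sq {k : ℕ} {c : ℝ} (hc : 0 < c) :
    Integrable (fun x : Fin k → ℝ => Real.exp (-c * ∑ i, x i ^ 2)) := by
  have h := Integrable.fintype_prod (ι := Fin k) (μ := fun _ => (volume : Measure ℝ))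
    (f := fun _ x => Real.exp (-c * x ^ 2)) fun _ => integrable_exp_neg_mul_sq hc
  refine h.congr (ae_of_all _ fun x => ?_)
  simp only [Finset.mul_sum, Real.exp_sum]

lemma exists_mul_sum_sq_le {A : Type*} [Fintype A] {k : ℕ} {B : (Fin k → ℝ) →ₗ[ℝ] A → ℝ}
    (hB : Function.Injective B) : ∃ κ > (0 : ℝ), ∀ x, κ * ∑ i, x i ^ 2 ≤ ∑ α, B x α ^ 2 := by
  obtain ⟨K, hK, hKB⟩ := B.exists_antilipschitzWith (LinearMap.ker_eq_bot.2 hB)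
  have hK' : (0 : ℝ) < K := hK
  -- The factor `k` passes from the sup norm to the sum of squares; the `+ 1` keeps the constant
  -- positive when `k = 0`.
  refine ⟨((k : ℝ) * K ^ 2 + 1)⁻¹, by positivity, fun x => ?_⟩
  have h1 : ‖x‖ ≤ K * ‖B x‖ := by
    have := hKB.le_mul_dist x 0
    simpa using this
  have h2 : ‖B x‖ ≤ √(∑ α, B x α ^ 2) := by
    refine (pi_norm_le_iff_of_nonneg (Real.sqrt_nonneg _)).2 fun α => Real.abs_le_sqrt ?_
    exact Finset.single_le_sum (f := fun α => B x α ^ 2) (fun β _ => sq_nonneg _)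
      (Finset.mem_univ α)
  have hS : 0 ≤ ∑ α, B x α ^ 2 := Finset.sum_nonneg fun α _ => sq_nonneg _
  have h3 : ‖x‖ ^ 2 ≤ K ^ 2 * ∑ α, B x α ^ 2 := by
    calc ‖x‖ ^ 2 ≤ (K * √(∑ α, B x α ^ 2)) ^ 2 := by
          gcongr
          exact h1.trans (by gcongr)
      _ = _ := by rw [mul_pow, Real.sq_sqrt hS]
  have h4 : ∑ i, x i ^ 2 ≤ k * ‖x‖ ^ 2 := by
    calc ∑ i, x i ^ 2 ≤ ∑ _i : Fin k, ‖x‖ ^ 2 := by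
          refine Finset.sum_le_sum fun i _ => ?_
          rw [← sq_abs]
          gcongr
          exact norm_le_pi_norm x i
      _ = _ := by simp
  rw [inv_mul_le_iff₀ (by positivity)]
  nlinarith

section Laplace

variable {A : Type*} [Fintype A] {D : ℕ} {R : Matrix (Fin D) A ℝ} {f q : A → ℝ}
  {k : ℕ} {B : (Fin k → ℝ) →ₗ[ℝ] A → ℝ} {l : Filter ℕ}
  {r : ℕ → (Fin k → ℝ) → (Fin k → ℝ)}

/-- The weighted test function on the equivalence class. -/
noncomputable def gapWeight (R : Matrix (Fin D) A ℝ) (f q : A → ℝ) (φ : ℝ → ℝ) (N : ℕ) :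
    (A → ℝ) → ℝ :=
  (equivClass R f).indicator fun p => φ (2 * N * (shannonEntropy q - shannonEntropy p)) *
    Real.exp (-(N * (shannonEntropy q - shannonEntropy p)))

lemma measurable_gapWeight {φ : ℝ → ℝ} (hφ : Continuous φ) (N : ℕ) :
    Measurable (gapWeight R f q φ N) := by
  refine Measurable.indicator ?_ (isClosed_equivClass R f).measurableSet
  have := (continuous_shannonEntropy (A := A))
  exact Continuous.measurable (by fun_prop)

/-- The integrable majorant, independent of `N`. The quadratic lower bound gives `exp (-κ |y|² /
4)`; since `y` is within 1 of `x` in each coordinate, `|x|² ≤ 2 |y|² + 2 k` converts this to decay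
in `x`. -/
lemma norm_gapWeight_le (hq : IsMaxEnt R f q) (hq0 : ∀ α, 0 < q α)
    (hnorm : ∃ c : Fin D → ℝ, c ᵥ* R = fun _ => 1) {κ : ℝ} (hκ : 0 < κ)
    (hBκ : ∀ x, κ * ∑ i, x i ^ 2 ≤ ∑ α, B x α ^ 2) (φ : BoundedContinuousFunction ℝ ℝ) {N : ℕ}
    (hN : 0 < N) {x y : Fin k → ℝ} (hxy : ∀ i, |y i - x i| ≤ (√N)⁻¹) :
    ‖gapWeight R f q φ N (q + (√N)⁻¹ • B y)‖ ≤
      ‖φ‖ * Real.exp (κ * k / 4) * Real.exp (-(κ / 8) * ∑ i, x i ^ 2) := by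
  have hN' : (0 : ℝ) < N := Nat.cast_pos.2 hN
  by_cases hmem : q + (√N)⁻¹ • B y ∈ equivClass R f
  swap
  · rw [gapWeight, Set.indicator_of_notMem hmem, norm_zero]
    positivity
  rw [gapWeight, Set.indicator_of_mem hmem, norm_mul, Real.norm_eq_abs (Real.exp _), Real.abs_exp,
    mul_assoc ‖φ‖, ← Real.exp_add]
  have h1 := hq.sum_sq_le_entropy_gap hq0 hnorm hmem
  have h2 : ∑ α, ((q + (√N)⁻¹ • B y) α - q α) ^ 2 / 4 = (N : ℝ)⁻¹ * ((∑ α, B y α ^ 2) / 4) := by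
    rw [Finset.sum_div, Finset.mul_sum]
    refine Finset.sum_congr rfl fun α _ => ?_
    simp only [Pi.add_apply, Pi.smul_apply, smul_eq_mul, add_sub_cancel_left, mul_pow, inv_pow,
      Real.sq_sqrt hN'.le]
    ring
  rw [h2, inv_mul_le_iff₀ hN'] at h1
  have h3 : ∑ i, x i ^ 2 ≤ 2 * ∑ i, y i ^ 2 + 2 * k := by
    calc ∑ i, x i ^ 2 ≤ ∑ i, (2 * y i ^ 2 + 2) := by
          refine Finset.sum_le_sum fun i _ => ?_
          have hle : |y i - x i| ≤ 1 := (hxy i).trans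
            (inv_le_one_of_one_le₀ (Real.one_le_sqrt.2 (by exact_mod_cast hN)))
          have h5 : (y i - x i) ^ 2 ≤ 1 := by
            rw [← sq_abs]; exact pow_le_one₀ (abs_nonneg _) hle
          nlinarith [sq_nonneg (2 * y i - x i)]
      _ = _ := by simp [Finset.sum_add_distrib, Finset.mul_sum, mul_comm]
  have h4 := hBκ y
  have h6 := mul_le_mul_of_nonneg_left h3 hκ.le
  gcongr
  · exact φ.norm_coe_le_norm _
  · linarith

/-- As `q` is positive, the points eventually lie in the class, so the indicator is 1 and the scalar
expansions add up. -/
lemma tendsto_gapWeight (hq : IsMaxEnt R f q) (hq0 : ∀ α, 0 < q α)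
    (hnorm : ∃ c : Fin D → ℝ, c ᵥ* R = fun _ => 1) (hBR : ∀ x, R *ᵥ B x = 0) (hl : l ≤ atTop)
    {φ : ℝ → ℝ} (hφ : Continuous φ) {x : Fin k → ℝ} {y : ℕ → Fin k → ℝ}
    (hy : Tendsto y l (𝓝 x)) :
    Tendsto (fun N : ℕ => gapWeight R f q φ N (q + (√N)⁻¹ • B (y N))) l
      (𝓝 (φ (quadGap q B x) * Real.exp (-(quadGap q B x / 2)))) := by
  have hcast : Tendsto (fun N : ℕ => (N : ℝ)) l atTop := tendsto_natCast_atTop_atTop.mono_left hl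
  have hBy : ∀ α, Tendsto (fun N => B (y N) α) l (𝓝 (B x α)) := fun α =>
    ((continuous_apply α).comp B.continuous_of_finiteDimensional).continuousAt.tendsto.comp hy
  have hinv : Tendsto (fun N : ℕ => (√N)⁻¹) l (𝓝 0) :=
    tendsto_inv_atTop_zero.comp (Real.tendsto_sqrt_atTop.comp hcast)
  have hmem : ∀ᶠ N in l, q + (√(N : ℕ))⁻¹ • B (y N) ∈ equivClass R f := by
    have : ∀ᶠ N : ℕ in l, ∀ α, 0 < q α + (√N)⁻¹ * B (y N) α := by
      refine eventually_all.2 fun α => ?_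
      have := (hinv.mul (hBy α)).const_add (q α)
      exact this.eventually_const_lt (by simpa using hq0 α)
    filter_upwards [this] with N hN
    exact add_mem_equivClass hnorm hq.1 (by rw [Matrix.mulVec_smul, hBR, smul_zero])
      fun α => (hN α).le
  have hgap : Tendsto (fun N : ℕ => ∑ α, (N : ℝ) * klTerm (q α) (q α + (√N)⁻¹ * B (y N) α)) l
      (𝓝 (quadGap q B x / 2)) := by
    rw [quadGap, Finset.sum_div]
    exact tendsto_finsetSum _ fun α _ => tendsto_mul_klTerm hcast (hBy α) (hq0 α)
  have hlim := ((hφ.tendsto _).comp (hgap.const_mul 2)).mul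
    ((Real.continuous_exp.tendsto _).comp hgap.neg)
  rw [mul_div_cancel₀ _ (two_ne_zero' ℝ)] at hlim
  refine hlim.congr' ?_
  filter_upwards [hmem] with N hN
  rw [gapWeight, Set.indicator_of_mem hN, hq.entropy_gap hq0 hnorm hN, mul_assoc, Finset.mul_sum]
  rfl

/-- Laplace's method on the equivalence class. -/
theorem tendsto_integral_gapWeight (hq : IsMaxEnt R f q) (hq0 : ∀ α, 0 < q α)
    (hnorm : ∃ c : Fin D → ℝ, c ᵥ* R = fun _ => 1) (hB : Function.Injective B)
    (hBR : ∀ x, R *ᵥ B x = 0) [l.IsCountablyGenerated] (hl : l ≤ atTop)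
    (hrm : ∀ᶠ N in l, Measurable (r N)) (hr : ∀ᶠ N : ℕ in l, ∀ x i, |r N x i - x i| ≤ (√N)⁻¹)
    (φ : BoundedContinuousFunction ℝ ℝ) :
    Tendsto (fun N : ℕ => ∫ x, gapWeight R f q φ N (q + (√N)⁻¹ • B (r N x))) l
      (𝓝 (∫ x, φ (quadGap q B x) * Real.exp (-(quadGap q B x / 2)))) := by
  obtain ⟨κ, hκ, hBκ⟩ := exists_mul_sum_sq_le hB
  refine tendsto_integral_filter_of_dominated_convergence
    (fun x => ‖φ‖ * Real.exp (κ * k / 4) * Real.exp (-(κ / 8) * ∑ i, x i ^ 2)) ?_ ?_ ?_ ?_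
  · filter_upwards [hrm] with N hN
    refine Measurable.aestronglyMeasurable ?_
    refine (measurable_gapWeight φ.continuous N).comp ?_
    have hBm : Measurable B := B.continuous_of_finiteDimensional.measurable
    exact ((hBm.comp hN).const_smul (√(N : ℝ))⁻¹).const_add q
  · filter_upwards [hr, hl (eventually_gt_atTop 0)] with N hN hN0
    exact ae_of_all _ fun x => norm_gapWeight_le hq hq0 hnorm hκ hBκ φ hN0 (hN x)
  · exact (integrable_exp_neg_mul_sum_sq (by positivity)).const_mul _
  · refine ae_of_all _ fun x => tendsto_gapWeight hq hq0 hnorm hBR hl φ.continuous ?_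
    have hinv : Tendsto (fun N : ℕ => (√N)⁻¹) l (𝓝 0) :=
      tendsto_inv_atTop_zero.comp
        (Real.tendsto_sqrt_atTop.comp (tendsto_natCast_atTop_atTop.mono_left hl))
    refine tendsto_pi_nhds.2 fun i => tendsto_iff_norm_sub_tendsto_zero.2 ?_
    refine squeeze_zero' (Eventually.of_forall fun _ => norm_nonneg _) ?_ hinv
    filter_upwards [hr] with N hN using hN x i

end Laplace

/-! ### Gaussian integrals and the chi-squared law. -/

lemma pi_gaussianReal_eq_withDensity (ι : Type*) [Fintype ι] :
    Measure.pi (fun _ : ι => gaussianReal 0 1) =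
      (volume : Measure (ι → ℝ)).withDensity
        (fun x => ENNReal.ofReal (∏ i, gaussianPDFReal 0 1 (x i))) := by
  refine (Measure.pi_eq fun s hs => ?_)
  have hnn : ∀ x : ι → ℝ, 0 ≤ ∏ i, gaussianPDFReal 0 1 (x i) := fun x =>
    Finset.prod_nonneg fun i _ => gaussianPDFReal_nonneg _ _ _
  rw [withDensity_apply _ (MeasurableSet.univ_pi hs), volume_pi, Measure.restrict_pi_pi,
    ← ofReal_integral_eq_lintegral_ofReal _ (ae_of_all _ hnn),
    integral_fintype_prod_eq_prod (fun _ => gaussianPDFReal 0 1),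
    ENNReal.ofReal_prod_of_nonneg fun i _ => integral_nonneg (gaussianPDFReal_nonneg 0 1)]
  · exact Finset.prod_congr rfl fun i _ =>
      (gaussianReal_apply_eq_integral 0 one_ne_zero (s i)).symm
  · exact Integrable.fintype_prod fun i => (integrable_gaussianPDFReal 0 1).integrableOn

lemma integral_chiSquared (k : ℕ) (φ : ℝ → ℝ) (hφ : Continuous φ) :
    ∫ x, φ x ∂(chiSquared k) =
      (√(2 * Real.pi))⁻¹ ^ k * ∫ x : Fin k → ℝ,
        φ (∑ i, x i ^ 2) * Real.exp (-((∑ i, x i ^ 2) / 2)) := by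
  have hm : Measurable fun x : Fin k → ℝ => ∑ i, x i ^ 2 := by fun_prop
  rw [chiSquared, integral_map hm.aemeasurable hφ.aestronglyMeasurable]
  have hg : Measurable fun x : Fin k → ℝ => ENNReal.ofReal (∏ i, gaussianPDFReal 0 1 (x i)) :=
    (Finset.measurable_prod _ fun i _ =>
      (measurable_gaussianPDFReal 0 1).comp (measurable_pi_apply i)).ennreal_ofReal
  rw [pi_gaussianReal_eq_withDensity, integral_withDensity_eq_integral_toReal_smul hg
      (ae_of_all _ fun x => ENNReal.ofReal_lt_top),
    ← integral_const_mul]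
  refine integral_congr_ae (ae_of_all _ fun x => ?_)
  simp only []
  rw [ENNReal.toReal_ofReal (Finset.prod_nonneg fun i _ => gaussianPDFReal_nonneg _ _ _)]
  simp only [gaussianPDFReal, smul_eq_mul, sub_zero,
    NNReal.coe_one, mul_one, Finset.prod_mul_distrib, Finset.prod_const, Finset.card_univ,
    Fintype.card_fin, ← Real.exp_sum, neg_div, Finset.sum_neg_distrib, Finset.sum_div]
  ring

/-- Dividing coordinate `α` of `B x` by `√(q α)` makes the form a squared Euclidean norm on a
`k`-dimensional subspace; `L` takes coordinates in an orthonormal basis of it. -/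
lemma exists_linearEquiv_sum_sq_eq_quadGap {A : Type*} [Fintype A] {k : ℕ} {q : A → ℝ}
    (hq0 : ∀ α, 0 < q α) {B : (Fin k → ℝ) →ₗ[ℝ] A → ℝ} (hB : Function.Injective B) :
    ∃ L : (Fin k → ℝ) ≃ₗ[ℝ] (Fin k → ℝ), ∀ x, ∑ i, L x i ^ 2 = quadGap q B x := by
  let S : (A → ℝ) →ₗ[ℝ] (A → ℝ) := LinearMap.pi fun α => (√(q α))⁻¹ • LinearMap.proj α
  let M : (Fin k → ℝ) →ₗ[ℝ] EuclideanSpace ℝ A :=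
    (WithLp.linearEquiv 2 ℝ (A → ℝ)).symm.toLinearMap ∘ₗ S ∘ₗ B
  have hM : ∀ x α, M x α = (√(q α))⁻¹ * B x α := fun x α => rfl
  have hinj : Function.Injective M := by
    intro x y hxy
    refine hB (funext fun α => ?_)
    have := congrArg (fun v : EuclideanSpace ℝ A => v α) hxy
    simp only [hM] at this
    exact mul_left_cancel₀ (inv_ne_zero (Real.sqrt_pos.2 (hq0 α)).ne') this
  have hrank : Module.finrank ℝ (LinearMap.range M) = k := by
    rw [LinearMap.finrank_range_of_inj hinj, Module.finrank_fin_fun]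
  let b := (stdOrthonormalBasis ℝ (LinearMap.range M)).reindex (finCongr hrank)
  refine ⟨(LinearEquiv.ofInjective M hinj).trans (b.repr.toLinearEquiv.trans
    (WithLp.linearEquiv 2 ℝ (Fin k → ℝ))), fun x => ?_⟩
  have h1 : ∑ i, (b.repr (LinearEquiv.ofInjective M hinj x)) i ^ 2 = ‖M x‖ ^ 2 := by
    rw [← EuclideanSpace.real_norm_sq_eq, b.repr.norm_map]
    rfl
  refine h1.trans ?_
  rw [EuclideanSpace.real_norm_sq_eq, quadGap]
  refine Finset.sum_congr rfl fun α _ => ?_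
  rw [hM, mul_pow, inv_pow, Real.sq_sqrt (hq0 α).le]
  ring

/-- The constant `Z`, Jacobian times `(2π)^(k/2)`, does not depend on `φ`, so it cancels after
normalization. -/
lemma integral_comp_quadGap {A : Type*} [Fintype A] {k : ℕ} {q : A → ℝ}
    (hq0 : ∀ α, 0 < q α) {B : (Fin k → ℝ) →ₗ[ℝ] A → ℝ} (hB : Function.Injective B) :
    ∃ Z > (0 : ℝ), ∀ φ : ℝ → ℝ, Continuous φ →
      ∫ x, φ (quadGap q B x) * Real.exp (-(quadGap q B x / 2)) =
        Z * ∫ x, φ x ∂(chiSquared k) := by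
  obtain ⟨L, hL⟩ := exists_linearEquiv_sum_sq_eq_quadGap hq0 hB
  have hdet : LinearMap.det (L : (Fin k → ℝ) →ₗ[ℝ] (Fin k → ℝ)) ≠ 0 := L.isUnit_det'.ne_zero
  refine ⟨|(LinearMap.det (L : (Fin k → ℝ) →ₗ[ℝ] (Fin k → ℝ)))⁻¹| * √(2 * Real.pi) ^ k,
    by positivity, fun φ hφ => ?_⟩
  have hmap := Measure.map_linearMap_addHaar_eq_smul_addHaar (volume : Measure (Fin k → ℝ)) hdet
  have hemb : MeasurableEmbedding L :=
    L.toContinuousLinearEquiv.toHomeomorph.measurableEmbedding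
  have h := hemb.integral_map (μ := volume)
    (fun y : Fin k → ℝ => φ (∑ i, y i ^ 2) * Real.exp (-((∑ i, y i ^ 2) / 2)))
  simp only [hL] at h
  rw [← h, integral_chiSquared k φ hφ]
  change ∫ y, _ ∂(Measure.map (L : (Fin k → ℝ) →ₗ[ℝ] (Fin k → ℝ)) volume) = _
  rw [hmap, integral_smul_measure, ENNReal.toReal_ofReal (abs_nonneg _), smul_eq_mul]
  have hp : (√(2 * Real.pi)) ^ k ≠ 0 := by positivity
  rw [inv_pow]
  field_simp

instance (k : ℕ) : IsProbabilityMeasure (chiSquared k) :=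
  Measure.isProbabilityMeasure_map (Measurable.aemeasurable (by fun_prop))

/-- Level sets of the sum of squares lie in spheres, which are Lebesgue-null in positive dimension.
-/
lemma chiSquared_singleton {k : ℕ} (hk : k ≠ 0) (t : ℝ) : chiSquared k {t} = 0 := by
  have hm : Measurable fun x : Fin k → ℝ => ∑ i, x i ^ 2 := by fun_prop
  have : Nonempty (Fin k) := ⟨⟨0, Nat.pos_of_ne_zero hk⟩⟩
  rw [chiSquared, Measure.map_apply hm (measurableSet_singleton t),
    pi_gaussianReal_eq_withDensity]
  refine withDensity_absolutelyContinuous _ _ ?_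
  have hpre : (fun x : Fin k → ℝ => ∑ i, x i ^ 2) ⁻¹' {t} ⊆
      (@WithLp.toLp 2 (Fin k → ℝ)) ⁻¹' Metric.sphere 0 (√t) := by
    intro x hx
    have hx' : ∑ i, x i ^ 2 = t := hx
    simp only [Set.mem_preimage, mem_sphere_zero_iff_norm, EuclideanSpace.norm_eq,
      Real.norm_eq_abs, sq_abs, hx']
  refine measure_mono_null hpre ?_
  rw [(PiLp.volume_preserving_toLp (Fin k)).measure_preimage
    Metric.isClosed_sphere.nullMeasurableSet]
  exact Measure.addHaar_sphere _ _ _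

lemma chiSquared_zero : chiSquared 0 = Measure.dirac 0 := by
  have hm : Measurable fun x : Fin 0 → ℝ => ∑ i, x i ^ 2 := by fun_prop
  rw [chiSquared, Measure.pi_of_empty _ 0, Measure.map_dirac' hm]
  simp

lemma continuous_cdf {ν : Measure ℝ} [IsProbabilityMeasure ν] (hν : ∀ t, ν {t} = 0) :
    Continuous (cdf ν) := by
  refine continuous_iff_continuousAt.2 fun t => ?_
  rw [(monotone_cdf ν).continuousAt_iff_leftLim_eq_rightLim, StieltjesFunction.rightLim_eq]
  refine le_antisymm ((monotone_cdf ν).leftLim_le le_rfl) ?_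
  have h := (cdf ν).measure_singleton t
  rw [measure_cdf, hν t] at h
  linarith [ENNReal.ofReal_eq_zero.1 h.symm]

/-! ### From weak to uniform convergence of distribution functions. -/

/-- The piecewise linear function that is `1` up to `s` and `0` from `t` on. -/
noncomputable def rampDown (s t : ℝ) : BoundedContinuousFunction ℝ ℝ :=
  BoundedContinuousFunction.ofNormedAddCommGroup (fun x => max 0 (min 1 ((t - x) / (t - s))))
    (by fun_prop) 1 fun x => by
      rw [Real.norm_eq_abs, abs_of_nonneg (le_max_left _ _)]
      exact max_le zero_le_one (min_le_left _ _)

lemma rampDown_apply (s t x : ℝ) : rampDown s t x = max 0 (min 1 ((t - x) / (t - s))) := rfl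

section Polya

variable {Ω : Type*} [MeasurableSpace Ω]

lemma measureReal_le_integral_rampDown {P : Measure Ω} [IsProbabilityMeasure P] {X : Ω → ℝ}
    (hX : Measurable X) {s t : ℝ} (hst : s < t) :
    P.real {ω | X ω ≤ s} ≤ ∫ ω, rampDown s t (X ω) ∂P := by
  have hm : MeasurableSet {ω | X ω ≤ s} := measurableSet_le hX measurable_const
  rw [← integral_indicator_one hm]
  refine integral_mono ((integrable_const (1 : ℝ)).indicator hm) ?_ fun ω => ?_
  · exact Integrable.of_bound ((rampDown s t).continuous.measurable.comp hX).aestronglyMeasurable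
      _ (ae_of_all _ fun ω => (rampDown s t).norm_coe_le_norm _)
  · by_cases h : X ω ≤ s
    · rw [Set.indicator_of_mem (show ω ∈ {ω | X ω ≤ s} from h), rampDown_apply, Pi.one_apply]
      refine le_max_of_le_right (le_min le_rfl ?_)
      rw [le_div_iff₀ (by linarith)]
      linarith
    · rw [Set.indicator_of_notMem (show ω ∉ {ω | X ω ≤ s} from h), rampDown_apply]
      exact le_max_left _ _

lemma integral_rampDown_le_measureReal {P : Measure Ω} [IsProbabilityMeasure P] {X : Ω → ℝ}
    (hX : Measurable X) {s t : ℝ} (hst : s < t) :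
    ∫ ω, rampDown s t (X ω) ∂P ≤ P.real {ω | X ω ≤ t} := by
  have hm : MeasurableSet {ω | X ω ≤ t} := measurableSet_le hX measurable_const
  rw [← integral_indicator_one hm]
  refine integral_mono ?_ ((integrable_const (1 : ℝ)).indicator hm) fun ω => ?_
  · exact Integrable.of_bound ((rampDown s t).continuous.measurable.comp hX).aestronglyMeasurable
      _ (ae_of_all _ fun ω => (rampDown s t).norm_coe_le_norm _)
  · by_cases h : X ω ≤ t
    · rw [Set.indicator_of_mem (show ω ∈ {ω | X ω ≤ t} from h), rampDown_apply, Pi.one_apply]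
      exact max_le zero_le_one (min_le_left _ _)
    · rw [Set.indicator_of_notMem (show ω ∉ {ω | X ω ≤ t} from h), rampDown_apply]
      refine max_le le_rfl (min_le_of_right_le ?_)
      exact div_nonpos_of_nonpos_of_nonneg (by linarith [not_le.1 h]) (by linarith)

/-- Pólya's theorem: convergence in distribution to an atomless limit is uniform on the level of
distribution functions. -/
theorem eventually_forall_abs_measureReal_sub_cdf_lt {l : Filter ℕ} {P : ℕ → Measure Ω}
    {X : ℕ → Ω → ℝ} (hX : ∀ N, Measurable (X N)) {ν : Measure ℝ} [IsProbabilityMeasure ν]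
    (hν : ∀ t, ν {t} = 0) (hP : ∀ᶠ N in l, IsProbabilityMeasure (P N))
    (hlim : ∀ φ : BoundedContinuousFunction ℝ ℝ,
      Tendsto (fun N => ∫ ω, φ (X N ω) ∂(P N)) l (𝓝 (∫ x, φ x ∂ν))) {ε : ℝ} (hε : 0 < ε) :
    ∀ᶠ N in l, ∀ t, |(P N).real {ω | X N ω ≤ t} - cdf ν t| < ε := by
  have hupper : ∀ s t, s < t → ∀ᶠ N in l, (P N).real {ω | X N ω ≤ s} < cdf ν t + ε / 4 := by
    intro s t hst
    have h1 : ∫ x, rampDown s t x ∂ν ≤ cdf ν t := by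
      rw [cdf_eq_real]; exact integral_rampDown_le_measureReal measurable_id hst
    filter_upwards [hP, (hlim (rampDown s t)).eventually_lt_const
      (show _ < cdf ν t + ε / 4 by linarith)] with N hN h
    exact (measureReal_le_integral_rampDown (hX N) hst).trans_lt h
  have hlower : ∀ s t, s < t → ∀ᶠ N in l, cdf ν s - ε / 4 < (P N).real {ω | X N ω ≤ t} := by
    intro s t hst
    have h1 : cdf ν s ≤ ∫ x, rampDown s t x ∂ν := by
      rw [cdf_eq_real]; exact measureReal_le_integral_rampDown measurable_id hst
    filter_upwards [hP, (hlim (rampDown s t)).eventually_const_lt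
      (show cdf ν s - ε / 4 < _ by linarith)] with N hN h
    exact h.trans_le (integral_rampDown_le_measureReal (hX N) hst)
  have hmono : ∀ N, IsProbabilityMeasure (P N) → ∀ s t, s ≤ t →
      (P N).real {ω | X N ω ≤ s} ≤ (P N).real {ω | X N ω ≤ t} := fun N hN s t hst =>
    measureReal_mono fun ω (hω : X N ω ≤ s) => hω.trans hst
  have hF := monotone_cdf ν
  obtain ⟨a, ha⟩ := ((tendsto_cdf_atBot ν).eventually_lt_const
    (show (0 : ℝ) < ε / 4 by linarith)).exists
  obtain ⟨b, hb⟩ := ((tendsto_cdf_atTop ν).eventually_const_lt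
    (show 1 - ε / 4 < (1 : ℝ) by linarith)).exists
  have hmid : ∀ᶠ N in l, ∀ t ∈ Set.Icc (a - 1) (b + 1),
      |(P N).real {ω | X N ω ≤ t} - cdf ν t| < ε := by
    -- Near each point, continuity of `cdf ν` and monotonicity of both functions reduce the bound to
    -- finitely many thresholds; compactness glues the neighbourhoods.
    refine (isCompact_Icc (a := a - 1) (b := b + 1)).induction_on
      (p := fun s => ∀ᶠ N in l, ∀ t ∈ s, |(P N).real {ω | X N ω ≤ t} - cdf ν t| < ε) ?_ ?_ ?_ ?_
    · exact Eventually.of_forall fun N t ht => absurd ht (Set.notMem_empty t)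
    · exact fun s t hst h => h.mono fun N hN x hx => hN x (hst hx)
    · intro s t hs ht
      filter_upwards [hs, ht] with N h1 h2 x hx using hx.elim (h1 x) (h2 x)
    · intro t _
      have hc := Metric.continuous_iff.1 (continuous_cdf hν) t (ε / 8) (by linarith)
      obtain ⟨δ, hδ, hδF⟩ := hc
      have h1 := hδF (t - δ / 2) (by rw [Real.dist_eq, abs_lt]; constructor <;> linarith)
      have h2 := hδF (t + δ / 2) (by rw [Real.dist_eq, abs_lt]; constructor <;> linarith)
      rw [Real.dist_eq, abs_lt] at h1 h2
      refine ⟨Set.Icc (t - δ / 4) (t + δ / 4),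
        mem_nhdsWithin_of_mem_nhds (Icc_mem_nhds (by linarith) (by linarith)), ?_⟩
      filter_upwards [hP, hupper (t + δ / 4) (t + δ / 2) (by linarith),
        hlower (t - δ / 2) (t - δ / 4) (by linarith)] with N hN h3 h4 x hx
      have h5 := hmono N hN _ _ hx.1
      have h6 := hmono N hN _ _ hx.2
      have h7 := hF (show t - δ / 2 ≤ x by linarith [hx.1])
      have h8 := hF (show x ≤ t + δ / 2 by linarith [hx.2])
      rw [abs_lt]
      constructor <;> linarith
  -- Beyond the interval both functions are close to 0, respectively to 1.
  filter_upwards [hP, hmid, hupper (a - 1) a (by linarith), hlower b (b + 1) (by linarith)]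
    with N hN h1 h2 h3 t
  have h4 := cdf_nonneg ν t
  have h5 := cdf_le_one ν t
  have h6 : 0 ≤ (P N).real {ω | X N ω ≤ t} := measureReal_nonneg
  have h7 : (P N).real {ω | X N ω ≤ t} ≤ 1 := measureReal_le_one
  rcases lt_or_ge t (a - 1) with hlt | hge
  · have h8 := hmono N hN t (a - 1) hlt.le
    have h9 := hF (show t ≤ a by linarith)
    rw [abs_lt]
    constructor <;> linarith
  rcases le_or_gt t (b + 1) with hle | hgt
  · exact h1 t ⟨hge, hle⟩
  · have h8 := hmono N hN (b + 1) t hgt.le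
    have h9 := hF (show b ≤ t by linarith)
    rw [abs_lt]
    constructor <;> linarith

end Polya

/-! ### Normalized laws and the common concentration theorem. -/

section EntropyLaw

variable {A : Type*} [Fintype A] {D : ℕ} {R : Matrix (Fin D) A ℝ} {f q : A → ℝ}

lemma entropyLaw_smul {c : ENNReal} (hc : c ≠ 0) (hc' : c ≠ ⊤) (ρ : Measure (A → ℝ)) (N : ℕ) :
    entropyLaw (c • ρ) N = entropyLaw ρ N := by
  rw [entropyLaw, entropyLaw, lintegral_smul_measure, withDensity_smul_measure, smul_smul,
    smul_eq_mul, ENNReal.mul_inv (Or.inl hc) (Or.inl hc'), mul_comm c⁻¹, mul_assoc,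
    ENNReal.inv_mul_cancel hc hc', mul_one]

lemma entropyLaw_absolutelyContinuous (ρ : Measure (A → ℝ)) (N : ℕ) : entropyLaw ρ N ≪ ρ :=
  Measure.smul_absolutelyContinuous.trans (withDensity_absolutelyContinuous _ _)

lemma integral_exp_entropy_mul {X : Type*} [MeasurableSpace X] {μ : Measure X} {T : X → A → ℝ}
    (hT : Measurable T) {φ : ℝ → ℝ} (hφ : Continuous φ) (N : ℕ) :
    ∫ p, Real.exp (N * shannonEntropy p) *
        φ (2 * N * (shannonEntropy q - shannonEntropy p)) ∂(μ.map T).restrict (equivClass R f) =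
      Real.exp (N * shannonEntropy q) * ∫ x, gapWeight R f q φ N (T x) ∂μ := by
  rw [← integral_map hT.aemeasurable (measurable_gapWeight hφ N).aestronglyMeasurable, gapWeight,
    integral_indicator (isClosed_equivClass R f).measurableSet, ← integral_const_mul]
  refine integral_congr_ae (ae_of_all _ fun p => ?_)
  have : Real.exp (N * shannonEntropy p) = Real.exp (N * shannonEntropy q) *
      Real.exp (-(N * (shannonEntropy q - shannonEntropy p))) := by
    rw [← Real.exp_add]; ring_nf
  simp only [this]
  ring

lemma integral_entropyLaw_map {X : Type*} [MeasurableSpace X] {μ : Measure X} {T : X → A → ℝ}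
    (hT : Measurable T) {N : ℕ} (hpos : 0 < ∫ x, gapWeight R f q 1 N (T x) ∂μ) :
    IsProbabilityMeasure (entropyLaw ((μ.map T).restrict (equivClass R f)) N) ∧
    ∀ φ : ℝ → ℝ, Continuous φ →
      ∫ p, φ (2 * N * (shannonEntropy q - shannonEntropy p))
          ∂(entropyLaw ((μ.map T).restrict (equivClass R f)) N) =
        (∫ x, gapWeight R f q φ N (T x) ∂μ) / ∫ x, gapWeight R f q 1 N (T x) ∂μ := by
  set ρ := (μ.map T).restrict (equivClass R f)
  set I := ∫ x, gapWeight R f q 1 N (T x) ∂μ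
  have hexp : Measurable fun p : A → ℝ => Real.exp (N * shannonEntropy p) := by
    have := continuous_shannonEntropy (A := A)
    exact Continuous.measurable (by fun_prop)
  have h1 : ∫ p, Real.exp (N * shannonEntropy p) ∂ρ = Real.exp (N * shannonEntropy q) * I := by
    have := integral_exp_entropy_mul (R := R) (f := f) (q := q) (μ := μ) hT
      (φ := 1) continuous_one N
    simpa only [Pi.one_apply, mul_one] using this
  have hI : 0 < Real.exp (N * shannonEntropy q) * I := mul_pos (Real.exp_pos _) hpos
  have hint : Integrable (fun p => Real.exp (N * shannonEntropy p)) ρ := by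
    -- A non-integrable function has integral 0 by convention, which the positive value in `h1`
    -- excludes.
    by_contra h
    rw [integral_undef h] at h1
    linarith
  have hZ : ∫⁻ p, ENNReal.ofReal (Real.exp (N * shannonEntropy p)) ∂ρ =
      ENNReal.ofReal (Real.exp (N * shannonEntropy q) * I) := by
    rw [← h1, ofReal_integral_eq_lintegral_ofReal hint (ae_of_all _ fun p => (Real.exp_pos _).le)]
  have hZ0 : ENNReal.ofReal (Real.exp (N * shannonEntropy q) * I) ≠ 0 :=
    (ENNReal.ofReal_pos.2 hI).ne'
  refine ⟨⟨?_⟩, fun φ hφ => ?_⟩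
  · rw [entropyLaw, Measure.smul_apply, withDensity_apply _ MeasurableSet.univ,
      Measure.restrict_univ, hZ, smul_eq_mul, ENNReal.inv_mul_cancel hZ0 ENNReal.ofReal_ne_top]
  · rw [entropyLaw, hZ, integral_smul_measure, integral_withDensity_eq_integral_toReal_smul
      hexp.ennreal_ofReal (ae_of_all _ fun p => ENNReal.ofReal_lt_top)]
    simp only [ENNReal.toReal_ofReal (Real.exp_pos _).le, ENNReal.toReal_inv,
      ENNReal.toReal_ofReal hI.le, smul_eq_mul]
    rw [integral_exp_entropy_mul hT hφ]
    have := Real.exp_pos (N * shannonEntropy q)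
    field_simp

variable {k : ℕ} {B : (Fin k → ℝ) →ₗ[ℝ] A → ℝ} {l : Filter ℕ}
  {r : ℕ → (Fin k → ℝ) → (Fin k → ℝ)} {ρ : ℕ → Measure (A → ℝ)}

/-- Entropy concentration for reference measures that are, up to scaling, the images of Lebesgue
measure under approximations `q + B (r N x) / √N` of the linear coordinates around `q`. -/
theorem entropyConcentrates_of_coordinates (hq : IsMaxEnt R f q) (hq0 : ∀ α, 0 < q α)
    (hnorm : ∃ c : Fin D → ℝ, c ᵥ* R = fun _ => 1) (hB : Function.Injective B)
    (hBR : ∀ v, R *ᵥ v = 0 ↔ ∃ x, B x = v) [l.IsCountablyGenerated] (hl : l ≤ atTop)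
    (hrm : ∀ᶠ N in l, Measurable (r N)) (hr : ∀ᶠ N : ℕ in l, ∀ x i, |r N x i - x i| ≤ (√N)⁻¹)
    (hρ : ∀ᶠ N : ℕ in l, ∃ c : ENNReal, c ≠ 0 ∧ c ≠ ⊤ ∧ ρ N = c •
      ((volume : Measure (Fin k → ℝ)).map fun x => q + (√N)⁻¹ • B (r N x)).restrict
        (equivClass R f)) :
    EntropyConcentrates R f q k l (fun N => entropyLaw (ρ N) N) := by
  have hBR' : ∀ x, R *ᵥ B x = 0 := fun x => (hBR _).2 ⟨x, rfl⟩
  obtain ⟨Z, hZ, hZφ⟩ := integral_comp_quadGap hq0 hB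
  have hlim : ∀ φ : BoundedContinuousFunction ℝ ℝ,
      Tendsto (fun N : ℕ => ∫ x, gapWeight R f q φ N (q + (√N)⁻¹ • B (r N x))) l
        (𝓝 (Z * ∫ x, φ x ∂(chiSquared k))) := fun φ => by
    rw [← hZφ φ φ.continuous]
    exact tendsto_integral_gapWeight hq hq0 hnorm hB hBR' hl hrm hr φ
  have hone : Tendsto (fun N : ℕ => ∫ x, gapWeight R f q 1 N (q + (√N)⁻¹ • B (r N x))) l
      (𝓝 Z) := by
    have := hlim 1
    simpa using this
  have hlaw : ∀ᶠ N : ℕ in l, IsProbabilityMeasure (entropyLaw (ρ N) N) ∧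
      ∀ φ : ℝ → ℝ, Continuous φ →
        ∫ p, φ (2 * N * (shannonEntropy q - shannonEntropy p)) ∂(entropyLaw (ρ N) N) =
          (∫ x, gapWeight R f q φ N (q + (√N)⁻¹ • B (r N x))) /
            ∫ x, gapWeight R f q 1 N (q + (√N)⁻¹ • B (r N x)) := by
    filter_upwards [hρ, hone.eventually_const_lt hZ, hrm] with N ⟨c, hc, hc', hN⟩ hpos hm
    have hBm : Measurable B := B.continuous_of_finiteDimensional.measurable
    rw [hN, entropyLaw_smul hc hc']
    exact integral_entropyLaw_map (((hBm.comp hm).const_smul (√(N : ℝ))⁻¹).const_add q) hpos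
  have hprob := hlaw.mono fun N hN => hN.1
  have hweak : ∀ φ : BoundedContinuousFunction ℝ ℝ,
      Tendsto (fun N : ℕ => ∫ p, φ (2 * N * (shannonEntropy q - shannonEntropy p))
        ∂(entropyLaw (ρ N) N)) l (𝓝 (∫ x, φ x ∂(chiSquared k))) := by
    intro φ
    have h := (hlim φ).div hone hZ.ne'
    rw [mul_div_cancel_left₀ _ hZ.ne'] at h
    exact h.congr' (hlaw.mono fun N hN => (hN.2 φ φ.continuous).symm)
  have hclass : ∀ᶠ N : ℕ in l, ∀ᵐ p ∂(entropyLaw (ρ N) N), p ∈ equivClass R f := by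
    filter_upwards [hρ] with N ⟨c, hc, hc', hN⟩
    refine (entropyLaw_absolutelyContinuous (ρ N) N).ae_le ?_
    rw [hN]
    exact Measure.ae_smul_measure (ae_restrict_mem (isClosed_equivClass R f).measurableSet) c
  have hset : ∀ᶠ N : ℕ in l, ∀ δ > (0 : ℝ),
      (entropyLaw (ρ N) N).real {p | p ∈ equivClass R f ∧
        shannonEntropy q - δ ≤ shannonEntropy p ∧ shannonEntropy p ≤ shannonEntropy q} =
      (entropyLaw (ρ N) N).real {p | 2 * N * (shannonEntropy q - shannonEntropy p) ≤ 2 * N * δ} := by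
    filter_upwards [hclass, hl (eventually_gt_atTop 0)] with N hN hN0 δ hδ
    have hN' : (0 : ℝ) < N := Nat.cast_pos.2 hN0
    refine measureReal_congr ?_
    filter_upwards [hN] with p hp
    refine propext ⟨fun h => ?_, fun h => ⟨hp, ?_, hq.2 p hp⟩⟩
    · exact mul_le_mul_of_nonneg_left (by linarith [h.2.1]) (by positivity)
    · have := le_of_mul_le_mul_left (show 2 * (N : ℝ) * _ ≤ 2 * N * δ from h) (by positivity)
      linarith
  refine ⟨hprob, hweak, fun ε hε => ?_⟩
  -- For `k = 0` the limit is an atom at 0, so Pólya's theorem is unavailable; but then `p = q`, and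
  -- both probabilities are 1.
  rcases Nat.eq_zero_or_pos k with rfl | hk
  · filter_upwards [hset, hclass, hprob] with N h1 h2 h3 δ hδ
    have hgap : (entropyLaw (ρ N) N).real
        {p | 2 * N * (shannonEntropy q - shannonEntropy p) ≤ 2 * N * δ} = 1 := by
      rw [← probReal_univ (μ := entropyLaw (ρ N) N)]
      refine measureReal_congr ?_
      filter_upwards [h2] with p hp
      refine propext ⟨fun _ => trivial, fun _ => ?_⟩
      obtain ⟨x, hx⟩ := (hBR _).1 (mulVec_sub_eq_zero hp hq.1)
      rw [Subsingleton.elim x 0, map_zero] at hx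
      have hpq : p = q := (sub_eq_zero.1 hx.symm)
      change 2 * N * (shannonEntropy q - shannonEntropy p) ≤ 2 * N * δ
      rw [hpq, sub_self, mul_zero]
      positivity
    have hcdf : cdf (chiSquared 0) (2 * N * δ) = 1 := by
      have h0 : (0 : ℝ) ∈ Set.Iic (2 * N * δ) := Set.mem_Iic.2 (by positivity)
      rw [cdf_eq_real, chiSquared_zero, measureReal_def, Measure.dirac_apply_of_mem h0,
        ENNReal.toReal_one]
    rw [h1 δ hδ, hgap, hcdf, sub_self, abs_zero]
    exact hε
  · have hX : ∀ N : ℕ, Measurable fun p : A → ℝ =>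
        2 * (N : ℝ) * (shannonEntropy q - shannonEntropy p) := fun N => by
      have := continuous_shannonEntropy (A := A)
      exact Continuous.measurable (by fun_prop)
    filter_upwards [hset, eventually_forall_abs_measureReal_sub_cdf_lt hX
      (chiSquared_singleton hk.ne') hprob hweak hε] with N h1 h2 δ hδ
    rw [h1 δ hδ]
    exact h2 _

end EntropyLaw

/-! ### The Lebesgue setting. -/

lemma map_smul_add_volume {k : ℕ} {s : ℝ} (hs : 0 < s) (w : Fin k → ℝ) :
    ∃ c : ENNReal, c ≠ 0 ∧ c ≠ ⊤ ∧
      (volume : Measure (Fin k → ℝ)).map (fun x => s • x + w) = c • volume := by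
  refine ⟨ENNReal.ofReal |(s ^ Module.finrank ℝ (Fin k → ℝ))⁻¹|,
    (ENNReal.ofReal_pos.2 (by positivity)).ne', ENNReal.ofReal_ne_top, ?_⟩
  have h : (fun x : Fin k → ℝ => s • x + w) = (fun x => x + w) ∘ fun x => s • x := rfl
  rw [h, ← Measure.map_map (by fun_prop) (by fun_prop), Measure.map_addHaar_smul _ hs.ne',
    Measure.map_smul, map_add_right_eq_self]

section Continuous

variable {A : Type*} [Fintype A] {D : ℕ} {R : Matrix (Fin D) A ℝ} {f q : A → ℝ}

lemma finrank_ker_mulVecLin (hrank : R.rank = D) :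
    Module.finrank ℝ (LinearMap.ker R.mulVecLin) = Fintype.card A - D := by
  have h := LinearMap.finrank_range_add_finrank_ker R.mulVecLin
  rw [Module.finrank_fintype_fun_eq_card] at h
  have h2 : Module.finrank ℝ (LinearMap.range R.mulVecLin) = D := hrank
  omega

theorem entropyConcentrates_classVolume (hf : f ∈ stdSimplex ℝ A) (hrank : R.rank = D)
    (hnorm : ∃ c : Fin D → ℝ, c ᵥ* R = fun _ => 1) (hq : IsMaxEnt R f q)
    (hq0 : ∀ α, 0 < q α) :
    EntropyConcentrates R f q (Fintype.card A - D) atTop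
      (fun N => entropyLaw (classVolume R f) N) := by
  set k := Fintype.card A - D
  set K := LinearMap.ker R.mulVecLin
  let e : (Fin k → ℝ) ≃L[ℝ] K :=
    (Module.finBasisOfFinrankEq ℝ K (finrank_ker_mulVecLin hrank)).equivFun.symm
      |>.toContinuousLinearEquiv
  let B : (Fin k → ℝ) →ₗ[ℝ] A → ℝ := K.subtype ∘ₗ e.toLinearEquiv.toLinearMap
  have hBe : ∀ x, B x = (e x : A → ℝ) := fun x => rfl
  have hB : Function.Injective B := Subtype.val_injective.comp e.injective
  have hBR : ∀ v, R *ᵥ v = 0 ↔ ∃ x, B x = v := by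
    refine fun v => ⟨fun hv => ⟨e.symm ⟨v, hv⟩, ?_⟩, ?_⟩
    · rw [hBe, e.apply_symm_apply]
    · rintro ⟨x, rfl⟩
      exact (e x).2
  refine entropyConcentrates_of_coordinates (r := fun _ x => x) hq hq0 hnorm hB hBR le_rfl
    (Eventually.of_forall fun N => measurable_id) (Eventually.of_forall fun N x i => by simp) ?_
  filter_upwards [eventually_gt_atTop 0] with N hN
  have hs : 0 < √(N : ℝ) := Real.sqrt_pos.2 (Nat.cast_pos.2 hN)
  -- `B y = f - q` moves the origin from `f` to `q`; the rescaling by `√N` changes Lebesgue measure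
  -- only by a constant.
  obtain ⟨y, hy⟩ := (hBR _).1 (mulVec_sub_eq_zero ⟨hf, rfl⟩ hq.1)
  obtain ⟨c, hc, hc', hcN⟩ := map_smul_add_volume hs (√(N : ℝ) • y)
  set c₀ := (Measure.addHaar : Measure K).addHaarScalarFactor
    ((volume : Measure (Fin k → ℝ)).map e)
  have hhaar : (Measure.addHaar : Measure K) = c₀ • (volume : Measure (Fin k → ℝ)).map e :=
    Measure.isAddLeftInvariant_eq_smul _ _
  have hc₀ : c₀ ≠ 0 := (Measure.addHaarScalarFactor_pos_of_isAddHaarMeasure _ _).ne'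
  refine ⟨c₀ * c, mul_ne_zero (ENNReal.coe_ne_zero.2 hc₀) hc,
    ENNReal.mul_ne_top ENNReal.coe_ne_top hc', ?_⟩
  have hBm : Measurable B := B.continuous_of_finiteDimensional.measurable
  have hTm : Measurable fun x : Fin k → ℝ => q + (√(N : ℝ))⁻¹ • B x :=
    (hBm.const_smul (√(N : ℝ))⁻¹).const_add q
  have hfun : (fun v : K => f + v.1) ∘ e =
      (fun x => q + (√(N : ℝ))⁻¹ • B x) ∘ fun x => √(N : ℝ) • x + √(N : ℝ) • y := by
    funext x
    change f + B x = q + (√(N : ℝ))⁻¹ • B (√(N : ℝ) • x + √(N : ℝ) • y)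
    rw [← smul_add, map_smul, smul_smul, inv_mul_cancel₀ hs.ne', one_smul, map_add, hy]
    abel
  rw [classVolume, hhaar, Measure.map_smul, Measure.map_map (by fun_prop) e.continuous.measurable,
    hfun, ← Measure.map_map hTm (by fun_prop), hcN, Measure.map_smul, Measure.restrict_smul,
    Measure.restrict_smul, mul_smul]
  rfl

end Continuous

/-! ### Integer points of the kernel. -/

section Lattice

variable {A : Type*} [Fintype A] {D : ℕ} {R : Matrix (Fin D) A ℝ}

/-- The integer vectors in the kernel of `R`. -/
def kerLattice (R : Matrix (Fin D) A ℝ) : Submodule ℤ (LinearMap.ker R.mulVecLin) where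
  carrier := {v | ∀ α, ∃ z : ℤ, v.1 α = z}
  zero_mem' := fun α => ⟨0, by simp⟩
  add_mem' := fun {u v} hu hv α => by
    obtain ⟨y, hy⟩ := hu α
    obtain ⟨z, hz⟩ := hv α
    exact ⟨y + z, by simp [hy, hz]⟩
  smul_mem' := fun n v hv α => by
    obtain ⟨z, hz⟩ := hv α
    exact ⟨n * z, by simp [hz]⟩

instance : DiscreteTopology (kerLattice R) := by
  refine DiscreteTopology.of_forall_le_norm one_pos fun v hv => ?_
  have hne : v.1.1 ≠ 0 := fun h => hv (Subtype.ext (Subtype.ext h))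
  obtain ⟨α, hα⟩ := Function.ne_iff.1 hne
  obtain ⟨z, hz⟩ := v.2 α
  have hz0 : z ≠ 0 := by
    rintro rfl
    exact hα (by simpa using hz)
  have h1 : (1 : ℝ) ≤ |v.1.1 α| := by
    rw [hz]
    exact_mod_cast Int.one_le_abs hz0
  exact h1.trans (norm_le_pi_norm v.1.1 α)

lemma exists_nsmul_int (c : A → ℚ) : ∃ d : ℕ, d ≠ 0 ∧ ∀ α, ∃ z : ℤ, (d : ℚ) * c α = z := by
  classical
  refine ⟨∏ α, (c α).den, Finset.prod_ne_zero_iff.2 fun α _ => (c α).den_ne_zero, fun α => ?_⟩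
  refine ⟨(∏ β ∈ Finset.univ.erase α, (c β).den : ℕ) * (c α).num, ?_⟩
  rw [← Finset.prod_erase_mul _ _ (Finset.mem_univ α)]
  push_cast
  rw [mul_assoc, Rat.den_mul_eq_num]

/-- Expand the entries of `v` in a basis of `ℝ` over `ℚ`. A rational `R` acts on each coefficient
vector separately, so each is a rational kernel vector; clearing denominators puts it in the
lattice. -/
lemma span_kerLattice_eq_top (hR : ∀ a α, ∃ r : ℚ, R a α = r) :
    Submodule.span ℝ (kerLattice R : Set (LinearMap.ker R.mulVecLin)) = ⊤ := by
  classical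
  choose Q hQ using hR
  refine Submodule.eq_top_iff'.2 fun v => ?_
  let b := Module.Basis.ofVectorSpace ℚ ℝ
  have hv : R *ᵥ v.1 = 0 := v.2
  have hker : ∀ j, R *ᵥ (fun α => ((b.repr (v.1 α) j : ℚ) : ℝ)) = 0 := by
    intro j
    funext a
    have h1 : ∑ α, Q a α • v.1 α = 0 := by
      have := congrFun hv a
      simpa [Matrix.mulVec, dotProduct, hQ, Rat.smul_def] using this
    have h2 := congrArg (fun x => b.repr x j) h1
    simp only [map_sum, map_smul, Finsupp.coe_finsetSum, Finset.sum_apply, Finsupp.smul_apply,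
      smul_eq_mul, map_zero, Finsupp.coe_zero, Pi.zero_apply] at h2
    simp only [Matrix.mulVec, dotProduct, hQ, Pi.zero_apply]
    exact_mod_cast h2
  let u : Module.Basis.ofVectorSpaceIndex ℚ ℝ → LinearMap.ker R.mulVecLin := fun j => ⟨_, hker j⟩
  have hu : ∀ j, u j ∈ Submodule.span ℝ (kerLattice R : Set (LinearMap.ker R.mulVecLin)) := by
    intro j
    obtain ⟨d, hd, hz⟩ := exists_nsmul_int fun α => b.repr (v.1 α) j
    have hmem : (d : ℝ) • u j ∈ kerLattice R := by
      intro α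
      obtain ⟨z, hz⟩ := hz α
      refine ⟨z, ?_⟩
      change (d : ℝ) * ((b.repr (v.1 α) j : ℚ) : ℝ) = z
      exact_mod_cast hz
    have := Submodule.smul_mem _ (d : ℝ)⁻¹ (Submodule.subset_span (R := ℝ) hmem)
    rwa [smul_smul, inv_mul_cancel₀ (Nat.cast_ne_zero.2 hd), one_smul] at this
  let J := Finset.univ.biUnion fun α => (b.repr (v.1 α)).support
  have hsum : v = ∑ j ∈ J, (b j) • u j := by
    ext α
    have hJ : (b.repr (v.1 α)).support ⊆ J :=
      Finset.subset_biUnion_of_mem (fun α => (b.repr (v.1 α)).support) (Finset.mem_univ α)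
    have h1 := b.linearCombination_repr (v.1 α)
    rw [Finsupp.linearCombination_apply,
      Finsupp.sum_of_support_subset _ hJ (fun j c => c • b j) (fun j _ => zero_smul _ _)] at h1
    rw [← h1]
    simp only [Submodule.coe_sum, Finset.sum_apply, Submodule.coe_smul, Pi.smul_apply,
      smul_eq_mul, u, Rat.smul_def]
    exact Finset.sum_congr rfl fun j _ => mul_comm _ _
  rw [hsum]
  exact Submodule.sum_mem _ fun j _ => Submodule.smul_mem _ _ (hu j)

/-- The kernel lattice is discrete and spanning, so a `ℤ`-basis of it is an `ℝ`-basis of the kernel: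
integer vectors are those with integer coordinates. -/
lemma exists_lattice_coordinates (hrank : R.rank = D) (hR : ∀ a α, ∃ r : ℚ, R a α = r) :
    ∃ B : (Fin (Fintype.card A - D) → ℝ) →ₗ[ℝ] A → ℝ, Function.Injective B ∧
      (∀ v, R *ᵥ v = 0 ↔ ∃ x, B x = v) ∧
      (∀ n : Fin (Fintype.card A - D) → ℤ, ∀ α, ∃ z : ℤ, B (fun i => (n i : ℝ)) α = z) ∧
      ∀ v, R *ᵥ v = 0 → (∀ α, ∃ z : ℤ, v α = z) →
        ∃ n : Fin (Fintype.card A - D) → ℤ, B (fun i => (n i : ℝ)) = v := by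
  set K := LinearMap.ker R.mulVecLin
  have : IsZLattice ℝ (kerLattice R) := ⟨span_kerLattice_eq_top hR⟩
  have : Module.Finite ℤ (kerLattice R) := ZLattice.module_finite ℝ _
  have : Module.Free ℤ (kerLattice R) := ZLattice.module_free ℝ _
  let b := Module.finBasisOfFinrankEq ℤ (kerLattice R)
    ((ZLattice.rank ℝ (kerLattice R)).trans (finrank_ker_mulVecLin hrank))
  let e := (b.ofZLatticeBasis ℝ (kerLattice R)).equivFun.symm
  have he : ∀ n : Fin (Fintype.card A - D) → ℤ,
      e (fun i => (n i : ℝ)) = (b.equivFun.symm n : kerLattice R) := by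
    intro n
    simp only [e, Module.Basis.equivFun_symm_apply, Module.Basis.ofZLatticeBasis_apply,
      Submodule.coe_sum, Submodule.coe_smul, Int.cast_smul_eq_zsmul]
  refine ⟨K.subtype ∘ₗ e.toLinearMap, Subtype.val_injective.comp e.injective,
    fun v => ⟨fun hv => ⟨e.symm ⟨v, hv⟩, ?_⟩, ?_⟩, fun n α => ?_, fun v hv hz => ?_⟩
  · simp
  · rintro ⟨x, rfl⟩
    exact (e x).2
  · have := (b.equivFun.symm n).2 α
    rw [← he] at this
    exact this
  · refine ⟨b.equivFun ⟨⟨v, hv⟩, hz⟩, ?_⟩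
    change (e _ : A → ℝ) = v
    rw [he, LinearEquiv.symm_apply_apply]

end Lattice

/-! ### The counting setting. -/

lemma map_floor_volume (k : ℕ) :
    (volume : Measure (Fin k → ℝ)).map (fun x i => ⌊x i⌋) = Measure.count := by
  have hm : Measurable fun (x : Fin k → ℝ) i => ⌊x i⌋ :=
    measurable_pi_lambda _ fun i => (measurable_pi_apply i).floor
  refine Measure.ext_of_singleton fun n => ?_
  rw [Measure.map_apply hm (measurableSet_singleton n), Measure.count_singleton]
  have hpre : (fun (x : Fin k → ℝ) i => ⌊x i⌋) ⁻¹' {n} =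
      Set.pi Set.univ fun i => Set.Ico (n i : ℝ) (n i + 1) := by
    ext x
    simp only [Set.mem_preimage, Set.mem_singleton_iff, funext_iff, Int.floor_eq_iff, Set.mem_pi,
      Set.mem_univ, true_implies, Set.mem_Ico]
  rw [hpre, Real.volume_pi_Ico]
  simp

lemma map_count_of_injective {X Y : Type*} [MeasurableSpace X] [MeasurableSpace Y]
    [MeasurableSingletonClass X] [MeasurableSingletonClass Y] {ψ : X → Y}
    (hψ : Measurable ψ) (hinj : Function.Injective ψ) {s : Set Y} (hs : MeasurableSet s) :
    ((Measure.count : Measure X).map ψ).restrict s = Measure.count.restrict (Set.range ψ ∩ s) := by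
  refine Measure.ext fun t ht => ?_
  rw [Measure.restrict_apply ht, Measure.map_apply hψ (ht.inter hs), Measure.restrict_apply ht,
    ← Measure.count_injective_image hinj, Set.image_preimage_eq_inter_range]
  congr 1
  ext y
  simp only [Set.mem_inter_iff]
  tauto

section Discrete

variable {A : Type*} [Fintype A] {D : ℕ} {R : Matrix (Fin D) A ℝ} {f q : A → ℝ}

lemma countClass_eq_range_inter {k : ℕ} {B : (Fin k → ℝ) →ₗ[ℝ] A → ℝ}
    (hBint : ∀ n : Fin k → ℤ, ∀ α, ∃ z : ℤ, B (fun i => (n i : ℝ)) α = z)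
    (hBlat : ∀ v, R *ᵥ v = 0 → (∀ α, ∃ z : ℤ, v α = z) →
      ∃ n : Fin k → ℤ, B (fun i => (n i : ℝ)) = v)
    {N : ℕ} (hN : 0 < N) {p : A → ℝ} (hp : p ∈ countClass R f N) :
    countClass R f N =
      Set.range (fun n : Fin k → ℤ => p + (N : ℝ)⁻¹ • B (fun i => (n i : ℝ))) ∩
        equivClass R f := by
  have hN' : (N : ℝ) ≠ 0 := Nat.cast_ne_zero.2 hN.ne'
  ext p'
  constructor
  · intro hp'
    refine ⟨?_, hp'.1⟩
    obtain ⟨n, hn⟩ := hBlat ((N : ℝ) • (p' - p))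
      (by rw [Matrix.mulVec_smul, mulVec_sub_eq_zero hp'.1 hp.1, smul_zero]) (fun α => by
        obtain ⟨a, ha⟩ := hp'.2 α
        obtain ⟨b, hb⟩ := hp.2 α
        refine ⟨a - b, ?_⟩
        simp only [Pi.smul_apply, Pi.sub_apply, smul_eq_mul, mul_sub, ha, hb]
        push_cast
        ring)
    refine ⟨n, ?_⟩
    simp only [hn, smul_smul, inv_mul_cancel₀ hN', one_smul, add_sub_cancel]
  · rintro ⟨⟨n, rfl⟩, hmem⟩
    refine ⟨hmem, fun α => ?_⟩
    obtain ⟨a, ha⟩ := hp.2 α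
    obtain ⟨z, hz⟩ := hBint n α
    have hval : (N : ℝ) * (p + (N : ℝ)⁻¹ • B (fun i => (n i : ℝ))) α = ((a + z : ℤ) : ℝ) := by
      simp only [Pi.add_apply, Pi.smul_apply, smul_eq_mul, mul_add, ha, hz,
        mul_inv_cancel_left₀ hN']
      push_cast
      ring
    have hnn : (0 : ℝ) ≤ ((a + z : ℤ) : ℝ) :=
      hval ▸ mul_nonneg (Nat.cast_nonneg N) (hmem.1.1 α)
    -- Membership in the class makes `a + z` nonnegative, so `toNat` loses nothing.
    refine ⟨(a + z : ℤ).toNat, ?_⟩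
    rw [hval]
    exact_mod_cast (Int.toNat_of_nonneg (by exact_mod_cast hnn)).symm

theorem entropyConcentrates_countClass (hrank : R.rank = D)
    (hnorm : ∃ c : Fin D → ℝ, c ᵥ* R = fun _ => 1) (hq : IsMaxEnt R f q)
    (hq0 : ∀ α, 0 < q α) (hR : ∀ a α, ∃ r : ℚ, R a α = r) :
    EntropyConcentrates R f q (Fintype.card A - D)
      (atTop ⊓ 𝓟 {N : ℕ | (countClass R f N).Nonempty})
      (fun N => entropyLaw (Measure.count.restrict (countClass R f N)) N) := by
  have hcoord := exists_lattice_coordinates hrank hR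
  generalize Fintype.card A - D = k at hcoord ⊢
  obtain ⟨B, hB, hBR, hBint, hBlat⟩ := hcoord
  -- A base point of the shifted lattice for each `N`; its position may vary freely with `N`.
  have hcenter : ∀ N : ℕ, ∃ y : Fin k → ℝ,
      (countClass R f N).Nonempty → q + B y ∈ countClass R f N := by
    intro N
    by_cases h : (countClass R f N).Nonempty
    · obtain ⟨p, hp⟩ := h
      obtain ⟨y, hy⟩ := (hBR _).1 (mulVec_sub_eq_zero hp.1 hq.1)
      exact ⟨y, fun _ => by rwa [hy, add_sub_cancel]⟩
    · exact ⟨0, fun h' => absurd h' h⟩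
  choose y hy using hcenter
  let w : ℕ → Fin k → ℝ := fun N => (N : ℝ) • y N
  -- For `p = q + B x / √N`, the coordinates of `N (p - q)` are `√N x`, and the admissible ones form
  -- `w N + ℤ^k`. Rounding down to this set moves `x` by less than `1 / √N`.
  let r : ℕ → (Fin k → ℝ) → (Fin k → ℝ) := fun N x i =>
    (√(N : ℝ))⁻¹ * (w N i + (⌊√(N : ℝ) * x i - w N i⌋ : ℤ))
  have hNev : ∀ᶠ N : ℕ in atTop ⊓ 𝓟 {N : ℕ | (countClass R f N).Nonempty},
      0 < N ∧ (countClass R f N).Nonempty :=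
    ((eventually_gt_atTop 0).filter_mono inf_le_left).and
      (Filter.eventually_inf_principal.2 (Eventually.of_forall fun N h => h))
  have hrm : ∀ N, Measurable (r N) := fun N =>
    measurable_pi_lambda _ fun i => by
      have h1 : Measurable fun x : Fin k → ℝ => ((⌊√(N : ℝ) * x i - w N i⌋ : ℤ) : ℝ) :=
        measurable_from_top.comp
          (show Measurable fun x : Fin k → ℝ => √(N : ℝ) * x i - w N i by fun_prop).floor
      exact (h1.const_add _).const_mul _
  refine entropyConcentrates_of_coordinates (r := r) hq hq0 hnorm hB hBR inf_le_left
    (Eventually.of_forall hrm) ?_ ?_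
  · filter_upwards [hNev] with N ⟨hN, _⟩ x i
    have hs : 0 < √(N : ℝ) := Real.sqrt_pos.2 (Nat.cast_pos.2 hN)
    have h1 : r N x i - x i = -((√(N : ℝ))⁻¹ * Int.fract (√(N : ℝ) * x i - w N i)) := by
      simp only [r, Int.fract]
      field_simp
      ring
    rw [h1, abs_neg, abs_mul, abs_of_pos (inv_pos.2 hs), abs_of_nonneg (Int.fract_nonneg _)]
    exact mul_le_of_le_one_right (inv_pos.2 hs).le (Int.fract_lt_one _).le
  · filter_upwards [hNev] with N ⟨hN, hne⟩
    have hN' : (0 : ℝ) < N := Nat.cast_pos.2 hN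
    have hs : 0 < √(N : ℝ) := Real.sqrt_pos.2 hN'
    obtain ⟨c, hc, hc', hcN⟩ := map_smul_add_volume hs (-w N)
    -- Each rounding cell has the same volume `c`, so `c⁻¹` gives every lattice point unit mass.
    refine ⟨c⁻¹, ENNReal.inv_ne_zero.2 hc', ENNReal.inv_ne_top.2 hc, ?_⟩
    let ψ : (Fin k → ℤ) → (A → ℝ) := fun n => (q + B (y N)) + (N : ℝ)⁻¹ • B (fun i => (n i : ℝ))
    have hψm : Measurable ψ := measurable_of_countable ψ
    have hψinj : Function.Injective ψ := by
      intro m n hmn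
      have h1 := hB (smul_right_injective _ (inv_ne_zero hN'.ne')
        (add_left_cancel (show _ + _ • _ = _ + _ • _ from hmn)))
      exact funext fun i => Int.cast_injective (congrFun h1 i)
    have hfloor : Measurable fun (x : Fin k → ℝ) i => ⌊x i⌋ :=
      measurable_pi_lambda _ fun i => (measurable_pi_apply i).floor
    have hfun : (fun x => q + (√(N : ℝ))⁻¹ • B (r N x)) =
        ψ ∘ (fun x i => ⌊x i⌋) ∘ fun x => √(N : ℝ) • x + -w N := by
      funext x
      have h1 : (√(N : ℝ))⁻¹ • r N x =
          y N + (N : ℝ)⁻¹ • fun i => ((⌊√(N : ℝ) * x i + -w N i⌋ : ℤ) : ℝ) := by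
        funext i
        have h2 : (√(N : ℝ))⁻¹ * (√(N : ℝ))⁻¹ = (N : ℝ)⁻¹ := by
          rw [← mul_inv, Real.mul_self_sqrt hN'.le]
        simp only [r, w, Pi.smul_apply, smul_eq_mul, Pi.add_apply, ← mul_assoc, h2,
          ← sub_eq_add_neg]
        rw [mul_add, inv_mul_cancel_left₀ hN'.ne']
      simp only [Function.comp_apply, ψ, ← map_smul, h1, map_add, Pi.add_apply, Pi.smul_apply,
        smul_eq_mul, Pi.neg_apply]
      abel
    rw [hfun, ← Measure.map_map hψm (hfloor.comp (by fun_prop)),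
      ← Measure.map_map hfloor (by fun_prop), hcN, Measure.map_smul, map_floor_volume,
      Measure.map_smul, Measure.restrict_smul, smul_smul, ENNReal.inv_mul_cancel hc hc', one_smul,
      map_count_of_injective hψm hψinj (isClosed_equivClass R f).measurableSet,
      countClass_eq_range_inter hBint hBlat hN (hy N hne)]

end Discrete

theorem theorem1 {A : Type*} [Fintype A] {D : ℕ} (R : Matrix (Fin D) A ℝ) (f : A → ℝ)
    -- `f` is a probability distribution on the microstates
    (hf : f ∈ stdSimplex ℝ A)
    -- full row rank
    (hrank : R.rank = D)
    -- normalization is one of the constraints (the all-one vector lies in the row space)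
    (hnorm : ∃ c : Fin D → ℝ, c ᵥ* R = fun _ => 1)
    -- no structural zeros: the constraints do not force any probability to vanish
    (hpos : ∀ α, ∃ p ∈ equivClass R f, 0 < p α) :
    -- the MaxEnt distribution exists and is unique
    (∃! q, IsMaxEnt R f q) ∧
    ∀ q, IsMaxEnt R f q →
      -- the whole equivalence class, weighted by `exp (N H[p])` against Lebesgue measure
      EntropyConcentrates R f q (Fintype.card A - D) atTop
        (fun N => entropyLaw (classVolume R f) N) ∧
      -- the finite sum over the members realizable by `N` records, for rational architectures
      -- and along the sample sizes `N` that admit such members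
      ((∀ a α, ∃ r : ℚ, R a α = r) →
        EntropyConcentrates R f q (Fintype.card A - D)
          (atTop ⊓ 𝓟 {N : ℕ | (countClass R f N).Nonempty})
          (fun N => entropyLaw (Measure.count.restrict (countClass R f N)) N)) :=
  ⟨existsUnique_isMaxEnt hf hnorm hpos, fun _ hq =>
    ⟨entropyConcentrates_classVolume hf hrank hnorm hq (hq.pos hpos),
      entropyConcentrates_countClass hrank hnorm hq (hq.pos hpos)⟩⟩
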